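/- **Theorem (CAN elimination for HMR).** If a hypersequent $G$ has a derivation in the hypersequent calculus **HMR** for modal Riesz spaces, then $G$ has a CAN-free derivation in **HMR**, i.e. one that never uses the rule CAN. *Definitions.* Scalars $r,s,\dots$ are strictly positive reals. Terms (in negation normal form) over a countable set of variables $x$ are given by $$A ::= x \mid \overline{x} \mid 0 \mid 1 \mid \overline{1} \mid A+A \mid rA \mid A\sqcup A \mid A\sqcap A \mid \Diamond A .$$ The negation $\overline{A}$ of a term exchanges $x$ and $\overline{x}$, $1$ and $\overline{1}$, $\sqcup$ and $\sqcap$, and commutes with $0$, $+$, scalars and $\Diamond$. A *weighted term* is a pair $r.A$; a *sequent* $\vdash\Gamma$ is a finite, possibly empty, multiset $\Gamma$ of weighted terms; a *hypersequent* is a finite non-empty multiset $\vdash\Gamma_1\mid\dots\mid\;\vdash\Gamma_n$ of sequents. For a finite, possibly empty, sequence of scalars $\vec r=(r_1,\dots,r_n)$ let $\vec r.A$ be the multiset $r_1.A,\dots,r_n.A$, let $\sum\vec r=r_1+\dots+r_n$ and $s\vec r=(sr_1,\dots,sr_n)$. Further, $s.\Gamma$ multiplies every weight of $\Gamma$ by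 $s$, and $\Diamond\Gamma$ replaces every $r.A$ in $\Gamma$ by $r.\Diamond A$. The rules of **HMR** are the following ($G$ is a side hypersequent, which may be absent in the rules other than W, and "premises $\Rightarrow$ conclusion"): - INIT: $\Rightarrow\ \vdash$ (the single empty sequent). - W: $G \Rightarrow G\mid\;\vdash\Gamma$. - C: $G\mid\;\vdash\Gamma\mid\;\vdash\Gamma \Rightarrow G\mid\;\vdash\Gamma$. - S: $G\mid\;\vdash\Gamma_1,\Gamma_2 \Rightarrow G\mid\;\vdash\Gamma_1\mid\;\vdash\Gamma_2$. - M: $G\mid\;\vdash\Gamma_1$ and $G\mid\;\vdash\Gamma_2 \Rightarrow G\mid\;\vdash\Gamma_1,\Gamma_2$. - T: $G\mid\;\vdash r.\Gamma \Rightarrow G\mid\;\vdash\Gamma$. - ID: $G\mid\;\vdash\Gamma \Rightarrow G\mid\;\vdash\Gamma,\vec r.x,\vec s.\overline{x}$, provided $\sum\vec r=\sum\vec s$. - $0$: $G\mid\;\vdash\Gamma \Rightarrow G\mid\;\vdash\Gamma,\vec r.0$. - $+$: $G\mid\;\vdash\Gamma,\vec r.A,\vec r.B \Rightarrow G\mid\;\vdash\Gamma,\vec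 r.(A+B)$. - $\times$: $G\mid\;\vdash\Gamma,(s\vec r).A \Rightarrow G\mid\;\vdash\Gamma,\vec r.(sA)$. - $\sqcup$: $G\mid\;\vdash\Gamma,\vec r.A\mid\;\vdash\Gamma,\vec r.B \Rightarrow G\mid\;\vdash\Gamma,\vec r.(A\sqcup B)$. - $\sqcap$: $G\mid\;\vdash\Gamma,\vec r.A$ and $G\mid\;\vdash\Gamma,\vec r.B \Rightarrow G\mid\;\vdash\Gamma,\vec r.(A\sqcap B)$. - $1$: $G\mid\;\vdash\Gamma \Rightarrow G\mid\;\vdash\Gamma,\vec r.1,\vec s.\overline{1}$, provided $\sum\vec r\ge\sum\vec s$. - $\Diamond$: $\vdash\Gamma,\vec r.1,\vec s.\overline{1} \Rightarrow\ \vdash\Diamond\Gamma,\vec r.1,\vec s.\overline{1}$, provided $\sum\vec r\ge\sum\vec s$ (a single sequent, no side hypersequent). - CAN: $G\mid\;\vdash\Gamma,\vec s.A,\vec r.\overline{A} \Rightarrow G\mid\;\vdash\Gamma$, provided $\sum\vec r=\sum\vec s$. A derivation of $G$ is a finite tree built from these rules with conclusion $G$. -/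

import Mathlib

/-- The scalars of the calculus: strictly positive reals. -/
abbrev Scalar : Type := {r : ℝ // 0 < r}

/-- Terms of the language of modal Riesz spaces in negation normal form, over a set `V` of
variables. Negation occurs only on variables (`covar x`) and on the constant `1` (`negOne`). -/
inductive MTerm (V : Type*) where
  | var (x : V) : MTerm V
  | covar (x : V) : MTerm V
  | zero : MTerm V
  | one : MTerm V
  | negOne : MTerm V
  | add (A B : MTerm V) : MTerm V
  | smul (s : Scalar) (A : MTerm V) : MTerm V
  | sup (A B : MTerm V) : MTerm V
  | inf (A B : MTerm V) : MTerm V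
  | dia (A : MTerm V) : MTerm V

/-- The negation of a term in negation normal form, again in negation normal form. -/
def MTerm.neg {V : Type*} : MTerm V → MTerm V
  | .var x => .covar x
  | .covar x => .var x
  | .zero => .zero
  | .one => .negOne
  | .negOne => .one
  | .add A B => .add A.neg B.neg
  | .smul s A => .smul s A.neg
  | .sup A B => .inf A.neg B.neg
  | .inf A B => .sup A.neg B.neg
  | .dia A => .dia A.neg

/-- A weighted term `r.A`. -/
abbrev WTerm (V : Type*) := Scalar × MTerm V

/-- A sequent: a possibly empty finite multiset of weighted terms. -/
abbrev Sequent (V : Type*) := Multiset (WTerm V)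

/-- A hypersequent: a non-empty finite multiset of sequents. -/
abbrev Hypersequent (V : Type*) := {G : Multiset (Sequent V) // G ≠ 0}

/-- `rs.A`, the multiset `r₁.A, …, rₙ.A`, for a possibly empty finite family `rs = r₁, …, rₙ` of
scalars. The order of the family is immaterial in all rules, so a multiset is used. -/
def weighted {V : Type*} (rs : Multiset Scalar) (A : MTerm V) : Sequent V :=
  rs.map fun r => (r, A)

/-- `s.Γ`: every weight in `Γ` is multiplied by `s`. -/
def scaleSequent {V : Type*} (s : Scalar) (Γ : Sequent V) : Sequent V :=
  Γ.map fun p => (s * p.1, p.2)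

/-- `◇Γ`: every weighted term `r.A` in `Γ` is replaced by `r.◇A`. -/
def diaSequent {V : Type*} (Γ : Sequent V) : Sequent V :=
  Γ.map fun p => (p.1, MTerm.dia p.2)

/-- The sum of a finite family of scalars, as a real number (`0` for the empty family). -/
def scalarSum (rs : Multiset Scalar) : ℝ :=
  (rs.map fun r => (r : ℝ)).sum

/-- Derivation trees of the hypersequent calculus HMR. The side context `G` of a rule may be the
empty multiset, in which case `Γ ::ₘ G` is the hypersequent with the single sequent `Γ`. The
conclusion of every derivation tree is non-empty, as the only axiom is non-empty and no rule leads
to the empty multiset. -/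
inductive HMR {V : Type*} : Multiset (Sequent V) → Type _ where
  | init : HMR {0}
  | W (G : Multiset (Sequent V)) (Γ : Sequent V) (d : HMR G) : HMR (Γ ::ₘ G)
  | C (G : Multiset (Sequent V)) (Γ : Sequent V) (d : HMR (Γ ::ₘ Γ ::ₘ G)) : HMR (Γ ::ₘ G)
  | S (G : Multiset (Sequent V)) (Γ₁ Γ₂ : Sequent V) (d : HMR ((Γ₁ + Γ₂) ::ₘ G)) :
      HMR (Γ₁ ::ₘ Γ₂ ::ₘ G)
  | M (G : Multiset (Sequent V)) (Γ₁ Γ₂ : Sequent V) (d₁ : HMR (Γ₁ ::ₘ G))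
      (d₂ : HMR (Γ₂ ::ₘ G)) : HMR ((Γ₁ + Γ₂) ::ₘ G)
  | T (G : Multiset (Sequent V)) (Γ : Sequent V) (r : Scalar)
      (d : HMR (scaleSequent r Γ ::ₘ G)) : HMR (Γ ::ₘ G)
  | ID (G : Multiset (Sequent V)) (Γ : Sequent V) (rs ss : Multiset Scalar) (x : V)
      (h : scalarSum rs = scalarSum ss) (d : HMR (Γ ::ₘ G)) :
      HMR ((Γ + weighted rs (.var x) + weighted ss (.covar x)) ::ₘ G)
  | zero (G : Multiset (Sequent V)) (Γ : Sequent V) (rs : Multiset Scalar)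
      (d : HMR (Γ ::ₘ G)) : HMR ((Γ + weighted rs .zero) ::ₘ G)
  | add (G : Multiset (Sequent V)) (Γ : Sequent V) (rs : Multiset Scalar) (A B : MTerm V)
      (d : HMR ((Γ + weighted rs A + weighted rs B) ::ₘ G)) :
      HMR ((Γ + weighted rs (.add A B)) ::ₘ G)
  | smul (G : Multiset (Sequent V)) (Γ : Sequent V) (rs : Multiset Scalar) (s : Scalar)
      (A : MTerm V) (d : HMR ((Γ + weighted (rs.map fun r => s * r) A) ::ₘ G)) :
      HMR ((Γ + weighted rs (.smul s A)) ::ₘ G)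
  | sup (G : Multiset (Sequent V)) (Γ : Sequent V) (rs : Multiset Scalar) (A B : MTerm V)
      (d : HMR ((Γ + weighted rs A) ::ₘ (Γ + weighted rs B) ::ₘ G)) :
      HMR ((Γ + weighted rs (.sup A B)) ::ₘ G)
  | inf (G : Multiset (Sequent V)) (Γ : Sequent V) (rs : Multiset Scalar) (A B : MTerm V)
      (d₁ : HMR ((Γ + weighted rs A) ::ₘ G)) (d₂ : HMR ((Γ + weighted rs B) ::ₘ G)) :
      HMR ((Γ + weighted rs (.inf A B)) ::ₘ G)
  | one (G : Multiset (Sequent V)) (Γ : Sequent V) (rs ss : Multiset Scalar)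
      (h : scalarSum rs ≥ scalarSum ss) (d : HMR (Γ ::ₘ G)) :
      HMR ((Γ + weighted rs .one + weighted ss .negOne) ::ₘ G)
  | dia (Γ : Sequent V) (rs ss : Multiset Scalar) (h : scalarSum rs ≥ scalarSum ss)
      (d : HMR {Γ + weighted rs .one + weighted ss .negOne}) :
      HMR {diaSequent Γ + weighted rs .one + weighted ss .negOne}
  | CAN (G : Multiset (Sequent V)) (Γ : Sequent V) (rs ss : Multiset Scalar) (A : MTerm V)
      (h : scalarSum rs = scalarSum ss)
      (d : HMR ((Γ + weighted ss A + weighted rs A.neg) ::ₘ G)) : HMR (Γ ::ₘ G)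

/-- A derivation is CAN-free if it never uses the rule CAN. -/
def HMR.CANFree {V : Type*} : {G : Multiset (Sequent V)} → HMR G → Prop
  | _, .init => True
  | _, .W _ _ d => d.CANFree
  | _, .C _ _ d => d.CANFree
  | _, .S _ _ _ d => d.CANFree
  | _, .M _ _ _ d₁ d₂ => d₁.CANFree ∧ d₂.CANFree
  | _, .T _ _ _ d => d.CANFree
  | _, .ID _ _ _ _ _ _ d => d.CANFree
  | _, .zero _ _ _ d => d.CANFree
  | _, .add _ _ _ _ _ d => d.CANFree
  | _, .smul _ _ _ _ _ d => d.CANFree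
  | _, .sup _ _ _ _ _ d => d.CANFree
  | _, .inf _ _ _ _ _ d₁ d₂ => d₁.CANFree ∧ d₂.CANFree
  | _, .one _ _ _ _ _ d => d.CANFree
  | _, .dia _ _ _ _ d => d.CANFree
  | _, .CAN _ _ _ _ _ _ _ => False

/-!
The calculus is sound and its CAN-free fragment is complete for one and the same semantics, so
every derivable hypersequent has a CAN-free derivation.

An interpretation gives a real value to every variable, to `1`, and to every term `◇A`; it
extends to all terms through the operations of `ℝ`. The admissible interpretations (`Interp.Adm`)
form the smallest convex cone which contains those with `1 ≥ 0` and `◇ = 0`, and which contains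
with every `I` the interpretation where `◇A` has the value of `A` in `I`, the constant `1` keeps
its value, and the variables vanish. Such an interpretation is the root of a finite tree, `◇A`
being the sum of the values of `A` over the children, and the value of `1` at the root dominating
the sum of its values at the children.
A hypersequent is valid if in every admissible interpretation one of its sequents is nonnegative.

Soundness (`HMR.valid`) is a routine induction in which CAN is harmless, as `A` and its negation
have opposite values.

For completeness (`CutFree.of_valid`), the rules for `0`, `+`, scalars, `⊔` and `⊓` preserve
validity when read upwards, which reduces the claim to atomic hypersequents `Γ₁ | … | Γₙ`,
consisting of literals, `±1` and terms `◇A`. On atomic sequents the value is linear in the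
interpretation, so the vectors of values of the `Γᵢ` form a convex cone in `ℝⁿ`, and by validity
it misses the open negative orthant. The Hahn–Banach theorem gives `tᵢ ≥ 0`, not all zero, such
that `∑ tᵢ Γᵢ` is nonnegative everywhere (`exists_nonneg_combination`). Testing this combination
on special interpretations shows that its literals cancel, that the total weight of `1` is
nonnegative, and that removing one `◇` from every modal term leaves a valid sequent. That sequent
has smaller modal depth, so it has a CAN-free derivation by induction, and the rules ◇, ID, S, T
and W lead from it to the given hypersequent.
-/

/-! ### Interpretations -/

/-- An interpretation: the values of the variables, of the constant `1`, and of the terms `◇A`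
(the last component maps `A` to the value of `◇A`). As a product it is a real vector space. -/
abbrev Interp (V : Type*) := (V → ℝ) × ℝ × (MTerm V → ℝ)

namespace Interp

variable {V : Type*}

/-- The value of a term. Modal terms are not unfolded: their values are part of the data. -/
def eval (I : Interp V) : MTerm V → ℝ
  | .var x => I.1 x
  | .covar x => -I.1 x
  | .zero => 0
  | .one => I.2.1
  | .negOne => -I.2.1
  | .add A B => eval I A + eval I B
  | .smul s A => s * eval I A
  | .sup A B => max (eval I A) (eval I B)
  | .inf A B => min (eval I A) (eval I B)
  | .dia A => I.2.2 A

/-- The value of a sequent, the weighted sum of the values of its terms. -/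
def seq (I : Interp V) (Γ : Sequent V) : ℝ :=
  (Γ.map fun p => (p.1 : ℝ) * I.eval p.2).sum

/-- The admissible interpretations: the convex cone of those that arise at the root of a finite
tree. In `child`, the root of the new tree has the root of the old one as its only child. -/
inductive Adm : Interp V → Prop
  | base (ρ : V → ℝ) (e : ℝ) (he : 0 ≤ e) : Adm (ρ, e, 0)
  | add {I J : Interp V} (hI : Adm I) (hJ : Adm J) : Adm (I + J)
  | child {I : Interp V} (hI : Adm I) : Adm (0, I.2.1, I.eval)

theorem eval_smul (I : Interp V) {c : ℝ} (hc : 0 ≤ c) (A : MTerm V) :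
    (c • I).eval A = c * I.eval A := by
  induction A with
  | sup A B hA hB => simp only [eval, hA, hB, mul_max_of_nonneg _ _ hc]
  | inf A B hA hB => simp only [eval, hA, hB, mul_min_of_nonneg _ _ hc]
  | add A B hA hB => simp only [eval, hA, hB]; ring
  | smul s A hA => simp only [eval, hA]; ring
  | _ => simp [eval]

theorem Adm.smul {I : Interp V} (h : I.Adm) {c : ℝ} (hc : 0 ≤ c) : (c • I).Adm := by
  induction h with
  | base ρ e he =>
    convert Adm.base (c • ρ) (c * e) (mul_nonneg hc he) using 1
    ext <;> simp
  | add _ _ hI hJ => rw [smul_add]; exact hI.add hJ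
  | @child I _ hI =>
    convert hI.child using 1
    ext A <;> simp [eval_smul I hc]

theorem Adm.one_nonneg {I : Interp V} (h : I.Adm) : 0 ≤ I.2.1 := by
  induction h with
  | base ρ e he => exact he
  | add _ _ hI hJ => exact add_nonneg hI hJ
  | child _ hI => exact hI

theorem eval_neg_of_dia (I : Interp V) (h : ∀ A : MTerm V, I.2.2 A.neg = -I.2.2 A) (A : MTerm V) :
    I.eval A.neg = -I.eval A := by
  induction A with
  | sup A B hA hB => simp only [eval, MTerm.neg, hA, hB, min_neg_neg]
  | inf A B hA hB => simp only [eval, MTerm.neg, hA, hB, max_neg_neg]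
  | add A B hA hB => simp only [eval, MTerm.neg, hA, hB]; ring
  | smul s A hA => simp only [eval, MTerm.neg, hA]; ring
  | dia A _ => exact h A
  | _ => simp [eval, MTerm.neg]

theorem Adm.eval_neg {I : Interp V} (h : I.Adm) (A : MTerm V) : I.eval A.neg = -I.eval A := by
  refine eval_neg_of_dia I ?_ A
  induction h with
  | base ρ e he => simp
  | add _ _ hI hJ => intro A; simp only [Prod.snd_add, Pi.add_apply, hI, hJ]; ring
  | child _ hI => exact eval_neg_of_dia _ hI

@[simp] theorem seq_zero (I : Interp V) : I.seq 0 = 0 := by simp [seq]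

@[simp] theorem seq_add (I : Interp V) (Γ Δ : Sequent V) :
    I.seq (Γ + Δ) = I.seq Γ + I.seq Δ := by simp [seq]

@[simp] theorem seq_cons (I : Interp V) (p : WTerm V) (Γ : Sequent V) :
    I.seq (p ::ₘ Γ) = p.1 * I.eval p.2 + I.seq Γ := by simp [seq]

@[simp] theorem seq_weighted (I : Interp V) (rs : Multiset Scalar) (A : MTerm V) :
    I.seq (weighted rs A) = scalarSum rs * I.eval A := by
  simp [seq, weighted, scalarSum, Multiset.sum_map_mul_right]

@[simp] theorem seq_scale (I : Interp V) (s : Scalar) (Γ : Sequent V) :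
    I.seq (scaleSequent s Γ) = s * I.seq Γ := by
  simp [seq, scaleSequent, mul_assoc, Multiset.sum_map_mul_left]

theorem seq_sum (I : Interp V) (S : Multiset (Sequent V)) : I.seq S.sum = (S.map I.seq).sum := by
  induction S using Multiset.induction_on with
  | empty => simp
  | cons Γ S ih => simp [ih]

theorem seq_dia_add (I J : Interp V) (Γ : Sequent V) :
    (I + J).seq (diaSequent Γ) = I.seq (diaSequent Γ) + J.seq (diaSequent Γ) := by
  simp [seq, diaSequent, Function.comp_def, eval, mul_add]

@[simp] theorem seq_dia_base (ρ : V → ℝ) (e : ℝ) (Γ : Sequent V) :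
    seq (ρ, e, 0) (diaSequent Γ) = 0 := by
  simp [seq, diaSequent, Function.comp_def, eval]

@[simp] theorem seq_dia_child (I : Interp V) (ρ : V → ℝ) (e : ℝ) (Γ : Sequent V) :
    seq (ρ, e, I.eval) (diaSequent Γ) = I.seq Γ := by
  simp [seq, diaSequent, Function.comp_def, eval]

end Interp

/-! ### Validity and soundness -/

section Soundness

variable {V : Type*}

/-- A hypersequent is valid if every admissible interpretation makes one of its sequents
nonnegative. -/
def Valid (G : Multiset (Sequent V)) : Prop :=
  ∀ I : Interp V, I.Adm → ∃ Γ ∈ G, 0 ≤ I.seq Γ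

theorem valid_singleton {Γ : Sequent V} :
    Valid {Γ} ↔ ∀ I : Interp V, I.Adm → 0 ≤ I.seq Γ := by
  simp [Valid]

@[simp] theorem scalarSum_singleton (r : Scalar) : scalarSum {r} = r := by simp [scalarSum]

theorem scalarSum_map_mul (s : Scalar) (rs : Multiset Scalar) :
    scalarSum (rs.map fun r => s * r) = s * scalarSum rs := by
  simp [scalarSum, Multiset.sum_map_mul_left]

theorem scalarSum_nonneg (rs : Multiset Scalar) : 0 ≤ scalarSum rs := by
  refine Multiset.sum_nonneg fun x hx => ?_
  -- In `scalarSum` the family is coerced to a multiset of reals through the multiset monad.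
  simp only [Multiset.map_id', Multiset.bind_def, Multiset.pure_def, Multiset.mem_bind,
    Multiset.mem_singleton] at hx
  obtain ⟨r, -, rfl⟩ := hx
  exact r.2.le

/-- Soundness of the rule ◇. The claim is additive in the interpretation, so it suffices to check
the generators of the cone of admissible interpretations. -/
theorem Valid.dia {Γ : Sequent V} {rs ss : Multiset Scalar} (h : scalarSum rs ≥ scalarSum ss)
    (hv : Valid {Γ + weighted rs .one + weighted ss .negOne}) :
    Valid {diaSequent Γ + weighted rs .one + weighted ss .negOne} := by
  rw [valid_singleton] at hv ⊢
  intro I hI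
  induction hI with
  | base ρ e he =>
    simp only [Interp.seq_add, Interp.seq_weighted, Interp.eval, Interp.seq_dia_base]
    nlinarith
  | @add I J _ _ hI hJ =>
    simp only [Interp.seq_add, Interp.seq_weighted, Interp.eval, Interp.seq_dia_add, Prod.snd_add,
      Prod.fst_add] at *
    linarith
  | @child I hI _ =>
    have := hv I hI
    simpa [Interp.eval] using this

theorem Valid.cons_mono {Γ Δ : Sequent V} {G : Multiset (Sequent V)} (hv : Valid (Γ ::ₘ G))
    (h : ∀ I : Interp V, I.Adm → 0 ≤ I.seq Γ → 0 ≤ I.seq Δ) : Valid (Δ ::ₘ G) := by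
  intro I hI
  have := hv I hI
  simp only [Multiset.mem_cons, exists_eq_or_imp] at this ⊢
  exact this.imp_left (h I hI)

/-- Every derivable hypersequent is valid. -/
theorem HMR.valid {G : Multiset (Sequent V)} (d : HMR G) : Valid G := by
  induction d with
  | init => simp [Valid]
  | W G Γ _ ih =>
    intro I hI
    obtain ⟨Δ, hΔ, h⟩ := ih I hI
    exact ⟨Δ, Multiset.mem_cons_of_mem hΔ, h⟩
  | C G Γ _ ih =>
    intro I hI
    simpa using ih I hI
  | S G Γ₁ Γ₂ _ ih =>
    intro I hI
    have h := ih I hI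
    simp only [Multiset.mem_cons, exists_eq_or_imp, Interp.seq_add] at h ⊢
    rcases h with h | h
    · rcases le_total 0 (I.seq Γ₁) with h₁ | h₁
      · exact .inl h₁
      · right; left; linarith
    · exact .inr (.inr h)
  | M G Γ₁ Γ₂ _ _ ih₁ ih₂ =>
    intro I hI
    have h₁ := ih₁ I hI
    have h₂ := ih₂ I hI
    simp only [Multiset.mem_cons, exists_eq_or_imp, Interp.seq_add] at h₁ h₂ ⊢
    rcases h₁ with h₁ | h₁
    · exact h₂.imp_left fun h₂ => add_nonneg h₁ h₂
    · exact .inr h₁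
  | T G Γ r _ ih =>
    refine ih.cons_mono fun I _ h => ?_
    rw [Interp.seq_scale] at h
    exact nonneg_of_mul_nonneg_right h r.2
  | ID G Γ rs ss x h _ ih =>
    refine ih.cons_mono fun I _ hI => ?_
    simp only [Interp.seq_add, Interp.seq_weighted, Interp.eval, h]
    linarith
  | zero G Γ rs _ ih =>
    exact ih.cons_mono fun I _ hI => by simpa [Interp.eval] using hI
  | add G Γ rs A B _ ih =>
    refine ih.cons_mono fun I _ hI => ?_
    simp only [Interp.seq_add, Interp.seq_weighted, Interp.eval] at hI ⊢
    linarith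
  | smul G Γ rs s A _ ih =>
    refine ih.cons_mono fun I _ hI => ?_
    simp only [Interp.seq_add, Interp.seq_weighted, Interp.eval, scalarSum_map_mul] at hI ⊢
    linarith
  | sup G Γ rs A B _ ih =>
    intro I hI
    have h := ih I hI
    simp only [Multiset.mem_cons, exists_eq_or_imp, Interp.seq_add, Interp.seq_weighted,
      Interp.eval] at h ⊢
    have hA := mul_le_mul_of_nonneg_left (le_max_left (I.eval A) (I.eval B)) (scalarSum_nonneg rs)
    have hB := mul_le_mul_of_nonneg_left (le_max_right (I.eval A) (I.eval B)) (scalarSum_nonneg rs)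
    rcases h with h | h | h
    · left; linarith
    · left; linarith
    · exact .inr h
  | inf G Γ rs A B _ _ ih₁ ih₂ =>
    intro I hI
    have h₁ := ih₁ I hI
    have h₂ := ih₂ I hI
    simp only [Multiset.mem_cons, exists_eq_or_imp, Interp.seq_add, Interp.seq_weighted,
      Interp.eval] at h₁ h₂ ⊢
    rcases h₁ with h₁ | h₁
    · refine h₂.imp_left fun h₂ => ?_
      rcases min_choice (I.eval A) (I.eval B) with h | h <;> rwa [h]
    · exact .inr h₁
  | one G Γ rs ss h _ ih =>
    refine ih.cons_mono fun I hI hΓ => ?_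
    have := mul_le_mul_of_nonneg_right h hI.one_nonneg
    simp only [Interp.seq_add, Interp.seq_weighted, Interp.eval]
    linarith
  | dia Γ rs ss h _ ih => exact ih.dia h
  | CAN G Γ rs ss A h _ ih =>
    refine ih.cons_mono fun I hI hΓ => ?_
    simp only [Interp.seq_add, Interp.seq_weighted, hI.eval_neg, h] at hΓ
    linarith

end Soundness

/-! ### CAN-free derivability -/

/-- The hypersequent has a CAN-free derivation. (CAN plays the role of the cut rule.) -/
def CutFree {V : Type*} (G : Multiset (Sequent V)) : Prop := ∃ d : HMR G, d.CANFree

namespace CutFree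

variable {V : Type*} {G : Multiset (Sequent V)} {Γ : Sequent V}

theorem weaken (H : Multiset (Sequent V)) (h : CutFree G) : CutFree (H + G) := by
  induction H using Multiset.induction_on with
  | empty => simpa using h
  | cons Γ H ih =>
    obtain ⟨d, hd⟩ := ih
    rw [Multiset.cons_add]
    exact ⟨.W _ Γ d, hd⟩

/-- A hypersequent is derivable from any combination of its sequents with positive weights, by
the rules S and T. -/
theorem of_combination (P : Multiset (Scalar × Sequent V)) (hP : P ≠ 0)
    (h : CutFree ((P.map fun p => scaleSequent p.1 p.2).sum ::ₘ G)) :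
    CutFree (P.map Prod.snd + G) := by
  induction P using Multiset.induction_on generalizing G with
  | empty => exact absurd rfl hP
  | cons p P ih =>
    obtain ⟨d, hd⟩ := h
    rcases eq_or_ne P 0 with rfl | hP'
    · have e : ((p ::ₘ 0).map fun p : Scalar × Sequent V => scaleSequent p.1 p.2).sum =
          scaleSequent p.1 p.2 := by simp
      revert d
      rw [e]
      intro d hd
      rw [Multiset.map_cons, Multiset.map_zero, Multiset.cons_add, zero_add]
      exact ⟨.T G p.2 p.1 d, hd⟩
    · revert d
      rw [Multiset.map_cons, Multiset.sum_cons]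
      intro d hd
      have h₁ : CutFree ((P.map fun p => scaleSequent p.1 p.2).sum ::ₘ p.2 ::ₘ G) := by
        rw [Multiset.cons_swap]
        exact ⟨.T _ _ p.1 (.S _ _ _ d), hd⟩
      simpa using ih hP' h₁

/-- Literals that cancel under every valuation of the variables can be added to a sequent: for
each variable, a single application of ID adds all its occurrences. -/
theorem add_literals (Θ : Sequent V)
    (hΘ : ∀ p ∈ Θ, ∃ x, p.2 = .var x ∨ p.2 = .covar x)
    (h0 : ∀ ρ : V → ℝ, Interp.seq (ρ, 0, 0) Θ = 0) (h : CutFree (Γ ::ₘ G)) :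
    CutFree ((Γ + Θ) ::ₘ G) := by
  classical
  induction hn : Θ.card using Nat.strong_induction_on generalizing Θ Γ with
  | _ n ih =>
    rcases Multiset.empty_or_exists_mem Θ with rfl | ⟨p, hp⟩
    · simpa using h
    obtain ⟨x, hx⟩ := hΘ p hp
    set P := Θ.filter fun q => q.2 = .var x
    set N := (Θ.filter fun q => ¬ q.2 = .var x).filter fun q => q.2 = .covar x
    set R := (Θ.filter fun q => ¬ q.2 = .var x).filter fun q => ¬ q.2 = .covar x with hR
    have hsplit : Θ = P + N + R := by
      rw [add_assoc, Multiset.filter_add_not, Multiset.filter_add_not]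
    have hw : ∀ (Δ : Sequent V) (A : MTerm V), (∀ q ∈ Δ, q.2 = A) →
        weighted (Δ.map Prod.fst) A = Δ := by
      intro Δ A hA
      rw [weighted, Multiset.map_map]
      conv_rhs => rw [← Multiset.map_id Δ]
      exact Multiset.map_congr rfl fun q hq => by simp [← hA q hq]
    have hP := hw P (.var x) fun q hq => (Multiset.mem_filter.1 hq).2
    have hN := hw N (.covar x) fun q hq => (Multiset.mem_filter.1 hq).2
    have hRmem : ∀ q ∈ R, q ∈ Θ ∧ q.2 ≠ .var x ∧ q.2 ≠ .covar x := by
      intro q hq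
      simp only [hR, Multiset.mem_filter] at hq
      exact ⟨hq.1.1, hq.1.2, hq.2⟩
    -- The value of `R` does not depend on the value of `x`.
    have hRx : ∀ (ρ : V → ℝ) (c : ℝ),
        Interp.seq (Function.update ρ x c, 0, 0) R = Interp.seq (ρ, 0, 0) R := by
      intro ρ c
      unfold Interp.seq
      refine congrArg _ (Multiset.map_congr rfl fun q hq => ?_)
      obtain ⟨hqΘ, h1, h2⟩ := hRmem q hq
      obtain ⟨y, hy⟩ := hΘ q hqΘ
      have hyx : y ≠ x := by
        rintro rfl
        exact hy.elim h1 h2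
      rcases hy with hy | hy <;> simp [hy, Interp.eval, hyx]
    have hval : ∀ (ρ : V → ℝ) (c : ℝ),
        (scalarSum (P.map Prod.fst) - scalarSum (N.map Prod.fst)) * c +
          Interp.seq (ρ, 0, 0) R = 0 := by
      intro ρ c
      have := h0 (Function.update ρ x c)
      rw [hsplit, Interp.seq_add, Interp.seq_add, hRx, ← hP, ← hN] at this
      simp only [Interp.seq_weighted, Interp.eval, Function.update_self] at this
      linarith
    have hR0 : ∀ ρ : V → ℝ, Interp.seq (ρ, 0, 0) R = 0 := fun ρ => by
      have := hval ρ 0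
      linarith
    have hsum : scalarSum (P.map Prod.fst) = scalarSum (N.map Prod.fst) := by
      have h1 := hval 0 1
      have h2 := hR0 0
      linarith
    have hcard : R.card < n := by
      have hpR : p ∉ R := fun hpR => hx.elim (hRmem p hpR).2.1 (hRmem p hpR).2.2
      rw [← hn]
      refine Multiset.card_lt_card (lt_of_le_of_ne ?_ ?_)
      · rw [hsplit]; exact Multiset.le_add_left _ _
      · intro e
        exact hpR (e ▸ hp)
    obtain ⟨d, hd⟩ := h
    have h₁ : CutFree ((Γ + P + N) ::ₘ G) := by
      rw [← hP, ← hN]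
      exact ⟨.ID _ _ _ _ x hsum d, hd⟩
    have := ih _ hcard R (fun q hq => hΘ q (hRmem q hq).1) hR0 h₁ rfl
    rwa [add_assoc Γ, add_assoc Γ, ← hsplit] at this

end CutFree

/-! ### Atomic hypersequents -/

section Atomic

variable {V : Type*}

/-- Atomic terms: literals, the constants `1` and its negation, and modal terms. -/
def MTerm.IsAtomic : MTerm V → Prop
  | .var _ | .covar _ | .one | .negOne | .dia _ => True
  | .zero | .add _ _ | .smul _ _ | .sup _ _ | .inf _ _ => False

/-- The modal depth of a term. -/
def MTerm.depth : MTerm V → ℕ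
  | .var _ | .covar _ | .one | .negOne | .zero => 0
  | .smul _ A => A.depth
  | .add A B | .sup A B | .inf A B => max A.depth B.depth
  | .dia A => A.depth + 1

theorem Interp.eval_add_of_isAtomic (I J : Interp V) {A : MTerm V} (hA : A.IsAtomic) :
    (I + J).eval A = I.eval A + J.eval A := by
  cases A <;> simp_all [MTerm.IsAtomic, Interp.eval] <;> ring

theorem Interp.seq_add_of_isAtomic (I J : Interp V) {Γ : Sequent V}
    (hΓ : ∀ p ∈ Γ, p.2.IsAtomic) : (I + J).seq Γ = I.seq Γ + J.seq Γ := by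
  unfold Interp.seq
  rw [← Multiset.sum_map_add]
  refine congrArg _ (Multiset.map_congr rfl fun p hp => ?_)
  rw [Interp.eval_add_of_isAtomic I J (hΓ p hp), mul_add]

theorem Interp.seq_smul (I : Interp V) {c : ℝ} (hc : 0 ≤ c) (Γ : Sequent V) :
    (c • I).seq Γ = c * I.seq Γ := by
  unfold Interp.seq
  rw [← Multiset.sum_map_mul_left]
  refine congrArg _ (Multiset.map_congr rfl fun p hp => ?_)
  rw [Interp.eval_smul I hc, mul_left_comm]

/-- A convex set that misses the open negative orthant lies in a half-space with nonnegative
normal vector. -/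
theorem exists_nonneg_of_convex_of_forall_exists_nonneg {ι : Type*} [Fintype ι] [Nonempty ι]
    {D : Set (ι → ℝ)} (hD : Convex ℝ D) (h0 : 0 ∈ D) (h : ∀ y ∈ D, ∃ i, 0 ≤ y i) :
    ∃ t : ι → ℝ, (∀ i, 0 ≤ t i) ∧ (∃ i, 0 < t i) ∧ ∀ y ∈ D, 0 ≤ ∑ i, t i * y i := by
  classical
  set N : Set (ι → ℝ) := Set.univ.pi fun _ => Set.Iio 0
  have hN : IsOpen N := isOpen_set_pi Set.finite_univ fun _ _ => isOpen_Iio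
  have hNc : Convex ℝ N := convex_pi fun _ _ => convex_Iio 0
  have hdisj : Disjoint N D := by
    rw [Set.disjoint_left]
    intro y hy hyD
    obtain ⟨i, hi⟩ := h y hyD
    exact absurd (hy i trivial) (not_lt.2 hi)
  obtain ⟨f, u, hfN, hfD⟩ := geometric_hahn_banach_open hNc hN hD hdisj
  have hu : u ≤ 0 := by simpa using hfD 0 h0
  have hf : ∀ y, f y = ∑ i, f (Pi.single i 1) * y i := by
    intro y
    conv_lhs => rw [pi_eq_sum_univ' y]
    simp [mul_comm]
  -- The orthant is a cone with `0` in its closure, so the separating value can be taken to be `0`.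
  have hu0 : 0 ≤ u := by
    have hlim : Filter.Tendsto (fun c : ℝ => c * f fun _ => (-1 : ℝ)) (nhdsWithin 0 (Set.Ioi 0))
        (nhds (0 * f fun _ => (-1 : ℝ))) :=
      (Filter.tendsto_id.mono_left nhdsWithin_le_nhds).mul_const _
    rw [zero_mul] at hlim
    refine le_of_tendsto hlim ?_
    filter_upwards [self_mem_nhdsWithin] with c hc
    have hc' : (0 : ℝ) < c := hc
    have := hfN (c • fun _ => (-1 : ℝ)) fun i _ => by simpa using hc'
    rw [map_smul, smul_eq_mul] at this
    exact this.le
  have hu' : u = 0 := le_antisymm hu hu0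
  subst hu'
  refine ⟨fun i => f (Pi.single i 1), fun i => ?_, ?_, fun y hy => ?_⟩
  · -- Test on `-eᵢ - c (1, …, 1)` for small `c > 0`.
    by_contra hneg
    push Not at hneg
    have hlim : Filter.Tendsto (fun c : ℝ => -f (Pi.single i 1) + c * f fun _ => (-1 : ℝ))
        (nhdsWithin 0 (Set.Ioi 0)) (nhds (-f (Pi.single i 1) + 0 * f fun _ => (-1 : ℝ))) :=
      tendsto_const_nhds.add ((Filter.tendsto_id.mono_left nhdsWithin_le_nhds).mul_const _)
    have : -f (Pi.single i 1) + 0 * f (fun _ => (-1 : ℝ)) ≤ 0 := by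
      refine le_of_tendsto hlim ?_
      filter_upwards [self_mem_nhdsWithin] with c hc
      have hc' : (0 : ℝ) < c := hc
      have := hfN (-Pi.single i 1 + c • fun _ => (-1 : ℝ)) fun j _ => by
        by_cases hj : j = i
        · subst hj; simp; linarith
        · simp [hj, hc']
      rw [map_add, map_neg, map_smul, smul_eq_mul] at this
      exact this.le
    linarith
  · have h1 := hfN (fun _ => -1) fun i _ => by simp
    by_contra! hle
    rw [hf] at h1
    have : 0 ≤ ∑ i, f (Pi.single i 1) * (-1 : ℝ) :=
      Finset.sum_nonneg fun i _ => by linarith [hle i]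
    linarith
  · rw [← hf]; exact hfD y hy

/-- In a valid atomic hypersequent, some combination of the sequents with positive weights is
nonnegative in every admissible interpretation. -/
theorem exists_nonneg_combination {G : Multiset (Sequent V)}
    (hat : ∀ Γ ∈ G, ∀ p ∈ Γ, p.2.IsAtomic) (hG : Valid G) :
    ∃ P : Multiset (Scalar × Sequent V), P ≠ 0 ∧ P.map Prod.snd ≤ G ∧
      Valid {(P.map fun p => scaleSequent p.1 p.2).sum} := by
  classical
  obtain ⟨L, rfl⟩ : ∃ L : List (Sequent V), G = L := ⟨G.toList, G.coe_toList.symm⟩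
  have hmem : ∀ i, L.get i ∈ (L : Multiset (Sequent V)) := fun i => by simp
  set v : Interp V → Fin L.length → ℝ := fun I i => I.seq (L.get i) with hv
  have hadm0 : (0 : Interp V).Adm := Interp.Adm.base 0 0 le_rfl
  have hnonneg : ∀ I : Interp V, I.Adm → ∃ i, 0 ≤ v I i := by
    intro I hI
    obtain ⟨Γ, hΓ, h⟩ := hG I hI
    obtain ⟨i, rfl⟩ := List.get_of_mem (Multiset.mem_coe.1 hΓ)
    exact ⟨i, h⟩
  have : Nonempty (Fin L.length) := ⟨(hnonneg 0 hadm0).choose⟩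
  obtain ⟨t, ht, ⟨j, hj⟩, hD⟩ := exists_nonneg_of_convex_of_forall_exists_nonneg
    (D := v '' {I | I.Adm})
    (by
      rintro _ ⟨I, hI, rfl⟩ _ ⟨J, hJ, rfl⟩ a b ha hb -
      refine ⟨a • I + b • J, (hI.smul ha).add (hJ.smul hb), ?_⟩
      ext i
      simp only [hv, Interp.seq_add_of_isAtomic _ _ (hat _ (hmem i)), Interp.seq_smul _ ha,
        Interp.seq_smul _ hb, Pi.add_apply, Pi.smul_apply, smul_eq_mul])
    ⟨0, hadm0, by
      ext i
      have := Interp.seq_smul (0 : Interp V) le_rfl (L.get i)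
      rwa [zero_smul, zero_mul] at this⟩
    (by rintro _ ⟨I, hI, rfl⟩; exact hnonneg I hI)
  set F := Finset.univ.filter fun i => 0 < t i
  let w : Fin L.length → Scalar := fun i => if h : 0 < t i then ⟨t i, h⟩ else 1
  have hw : ∀ i ∈ F, (w i : ℝ) = t i := fun i hi => by
    simp [w, (Finset.mem_filter.1 hi).2]
  refine ⟨F.val.map fun i => (w i, L.get i), ?_, ?_, ?_⟩
  · have : j ∈ F := Finset.mem_filter.2 ⟨Finset.mem_univ _, hj⟩
    intro h
    rw [Multiset.map_eq_zero, Finset.val_eq_zero] at h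
    simp [h] at this
  · have e : (L : Multiset (Sequent V)) = Finset.univ.val.map L.get := by
      rw [Fin.univ_val_map, List.ofFn_get]
    rw [Multiset.map_map, e]
    exact Multiset.map_le_map (Finset.val_le_iff.2 (Finset.filter_subset _ _))
  · rw [valid_singleton]
    intro I hI
    rw [Interp.seq_sum, Multiset.map_map, Multiset.map_map]
    have h1 := hD _ ⟨I, hI, rfl⟩
    have h2 : ∑ i, t i * v I i = ∑ i ∈ F, t i * v I i := by
      refine (Finset.sum_subset (Finset.filter_subset _ _) fun i _ hi => ?_).symm
      have : ¬ 0 < t i := fun h => hi (Finset.mem_filter.2 ⟨Finset.mem_univ _, h⟩)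
      rw [le_antisymm (not_lt.1 this) (ht i), zero_mul]
    rw [h2] at h1
    refine h1.trans_eq (Finset.sum_congr rfl fun i hi => ?_)
    simp [hw i hi, hv]

/-- An atomic sequent splits into modal terms, multiples of `1` and of its negation, and
literals. -/
theorem exists_split_of_isAtomic {Γ : Sequent V} (hΓ : ∀ p ∈ Γ, p.2.IsAtomic) :
    ∃ (Δ : Sequent V) (rs ss : Multiset Scalar) (Θ : Sequent V),
      Γ = diaSequent Δ + weighted rs .one + weighted ss .negOne + Θ ∧
      ∀ p ∈ Θ, ∃ x, p.2 = .var x ∨ p.2 = .covar x := by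
  induction Γ using Multiset.induction_on with
  | empty => exact ⟨0, 0, 0, 0, by simp [diaSequent, weighted], by simp⟩
  | cons p Γ ih =>
    obtain ⟨Δ, rs, ss, Θ, rfl, hΘ⟩ := ih fun q hq => hΓ q (Multiset.mem_cons_of_mem hq)
    have hp := hΓ p (Multiset.mem_cons_self _ _)
    obtain ⟨r, A⟩ := p
    cases A with
    | var x =>
      refine ⟨Δ, rs, ss, (r, .var x) ::ₘ Θ, by simp, ?_⟩
      simpa using hΘ
    | covar x =>
      refine ⟨Δ, rs, ss, (r, .covar x) ::ₘ Θ, by simp, ?_⟩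
      simpa using hΘ
    | one => exact ⟨Δ, r ::ₘ rs, ss, Θ, by simp [weighted], hΘ⟩
    | negOne => exact ⟨Δ, rs, r ::ₘ ss, Θ, by simp [weighted], hΘ⟩
    | dia A => exact ⟨(r, A) ::ₘ Δ, rs, ss, Θ, by simp [diaSequent], hΘ⟩
    | _ => exact hp.elim

theorem Interp.seq_eq_of_literals {Θ : Sequent V}
    (hΘ : ∀ p ∈ Θ, ∃ x, p.2 = .var x ∨ p.2 = .covar x) (I : Interp V) :
    I.seq Θ = Interp.seq (I.1, 0, 0) Θ := by
  unfold Interp.seq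
  refine congrArg _ (Multiset.map_congr rfl fun p hp => ?_)
  obtain ⟨x, h | h⟩ := hΘ p hp <;> simp [h, Interp.eval]

theorem Interp.seq_literals_neg {Θ : Sequent V}
    (hΘ : ∀ p ∈ Θ, ∃ x, p.2 = .var x ∨ p.2 = .covar x) (ρ : V → ℝ) :
    Interp.seq (-ρ, 0, 0) Θ = -Interp.seq (ρ, 0, 0) Θ := by
  unfold Interp.seq
  rw [← neg_one_mul (Multiset.sum _), ← Multiset.sum_map_mul_left]
  refine congrArg _ (Multiset.map_congr rfl fun p hp => ?_)
  obtain ⟨x, h | h⟩ := hΘ p hp <;> simp [h, Interp.eval]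

/-- Completeness for a single atomic sequent, given completeness for single sequents of smaller
modal depth. -/
theorem CutFree.of_valid_of_isAtomic {Γ : Sequent V} {n : ℕ} (hΓ : ∀ p ∈ Γ, p.2.IsAtomic)
    (hn : ∀ p ∈ Γ, p.2.depth ≤ n)
    (ih : ∀ m < n, ∀ Γ : Sequent V, (∀ p ∈ Γ, p.2.depth ≤ m) → Valid {Γ} → CutFree {Γ})
    (hv : Valid {Γ}) : CutFree {Γ} := by
  obtain ⟨Δ, rs, ss, Θ, rfl, hΘ⟩ := exists_split_of_isAtomic hΓ
  rw [valid_singleton] at hv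
  have hlit : ∀ ρ : V → ℝ, Interp.seq (ρ, 0, 0) Θ = 0 := by
    have key : ∀ ρ : V → ℝ, 0 ≤ Interp.seq (ρ, 0, 0) Θ := by
      intro ρ
      have := hv _ (Interp.Adm.base ρ 0 le_rfl)
      simpa [Interp.eval] using this
    intro ρ
    have h1 := key ρ
    have h2 := key (-ρ)
    rw [Interp.seq_literals_neg hΘ] at h2
    linarith
  have hΘ0 : ∀ I : Interp V, I.seq Θ = 0 := fun I => by
    rw [Interp.seq_eq_of_literals hΘ, hlit]
  have hone : scalarSum rs ≥ scalarSum ss := by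
    have := hv _ (Interp.Adm.base 0 1 zero_le_one)
    simp only [Interp.seq_add, Interp.seq_dia_base, Interp.seq_weighted, Interp.eval, hΘ0] at this
    linarith
  refine CutFree.add_literals (G := 0) Θ hΘ hlit ?_
  rcases Multiset.empty_or_exists_mem Δ with rfl | ⟨p, hp⟩
  · exact ⟨.one 0 0 rs ss hone .init, trivial⟩
  have hdep : ∀ q ∈ Δ, q.2.depth + 1 ≤ n := fun q hq =>
    hn (q.1, .dia q.2) (by
      simp only [Multiset.mem_add]
      exact .inl (.inl (.inl (Multiset.mem_map_of_mem _ hq))))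
  have hlt : n - 1 < n := by have := hdep p hp; omega
  obtain ⟨d, hd⟩ := ih (n - 1) hlt (Δ + weighted rs .one + weighted ss .negOne)
    (by
      intro q hq
      simp only [Multiset.mem_add, weighted, Multiset.mem_map] at hq
      rcases hq with (hq | ⟨r, -, rfl⟩) | ⟨r, -, rfl⟩
      · have := hdep q hq; omega
      · simp [MTerm.depth]
      · simp [MTerm.depth])
    (by
      rw [valid_singleton]
      intro I hI
      have := hv _ hI.child
      simpa [Interp.eval, hΘ0] using this)
  exact ⟨.dia Δ rs ss hone d, hd⟩

end Atomic

/-! ### Completeness of the CAN-free calculus -/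

section Completeness

variable {V : Type*}

/-- The number of connectives outside the scope of all modalities. -/
def MTerm.complexity : MTerm V → ℕ
  | .var _ | .covar _ | .one | .negOne | .dia _ => 0
  | .zero => 1
  | .smul _ A => A.complexity + 1
  | .add A B | .sup A B | .inf A B => A.complexity + B.complexity + 1

/-- The total complexity of the terms of a sequent, counted with multiplicity; the weights play
no role. -/
def seqComplexity (Γ : Sequent V) : ℕ := (Γ.map fun p => p.2.complexity).sum

/-- The measure of a hypersequent for the decomposition of connectives. The powers of `3` make it
decrease when a sequent is replaced by two simpler ones, as in the rule for `⊔`. -/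
def hypComplexity (G : Multiset (Sequent V)) : ℕ := (G.map fun Γ => 3 ^ seqComplexity Γ).sum

theorem hypComplexity_cons (Γ : Sequent V) (G : Multiset (Sequent V)) :
    hypComplexity (Γ ::ₘ G) = 3 ^ seqComplexity Γ + hypComplexity G := by simp [hypComplexity]

theorem hypComplexity_lt {Γ Δ : Sequent V} (G : Multiset (Sequent V))
    (h : seqComplexity Δ < seqComplexity Γ) :
    hypComplexity (Δ ::ₘ G) < hypComplexity (Γ ::ₘ G) := by
  rw [hypComplexity_cons, hypComplexity_cons]
  exact Nat.add_lt_add_right (Nat.pow_lt_pow_right (by norm_num) h) _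

theorem hypComplexity_lt_of_two {Γ Δ₁ Δ₂ : Sequent V} (G : Multiset (Sequent V))
    (h₁ : seqComplexity Δ₁ < seqComplexity Γ) (h₂ : seqComplexity Δ₂ < seqComplexity Γ) :
    hypComplexity (Δ₁ ::ₘ Δ₂ ::ₘ G) < hypComplexity (Γ ::ₘ G) := by
  simp only [hypComplexity_cons]
  obtain ⟨k, hk⟩ := Nat.exists_eq_add_of_lt (lt_of_le_of_lt (Nat.zero_le _) h₁)
  have e : seqComplexity Γ = k + 1 := by omega
  have p₁ : 3 ^ seqComplexity Δ₁ ≤ 3 ^ k := Nat.pow_le_pow_right (by norm_num) (by omega)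
  have p₂ : 3 ^ seqComplexity Δ₂ ≤ 3 ^ k := Nat.pow_le_pow_right (by norm_num) (by omega)
  have : 0 < 3 ^ k := by positivity
  rw [e, pow_succ]
  omega

/-- All terms of the hypersequent have modal depth at most `n`. -/
def DepthLE (n : ℕ) (G : Multiset (Sequent V)) : Prop := ∀ Γ ∈ G, ∀ p ∈ Γ, p.2.depth ≤ n

theorem depthLE_cons {n : ℕ} {Γ : Sequent V} {G : Multiset (Sequent V)} :
    DepthLE n (Γ ::ₘ G) ↔ (∀ p ∈ Γ, p.2.depth ≤ n) ∧ DepthLE n G := by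
  simp [DepthLE]

/-- Completeness for hypersequents of bounded modal depth. -/
theorem CutFree.of_valid_of_depthLE (n : ℕ) (G : Multiset (Sequent V)) (hn : DepthLE n G)
    (hG : Valid G) : CutFree G := by
  classical
  induction n using Nat.strong_induction_on generalizing G with
  | _ n ihn =>
  induction hk : hypComplexity G using Nat.strong_induction_on generalizing G with
  | _ k ih =>
  subst hk
  by_cases hat : ∀ Γ ∈ G, ∀ p ∈ Γ, p.2.IsAtomic
  · obtain ⟨P, hP, hPG, hv⟩ := exists_nonneg_combination hat hG
    obtain ⟨H, rfl⟩ := Multiset.le_iff_exists_add.1 hPG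
    have hscale : ∀ p ∈ (P.map fun p => scaleSequent p.1 p.2).sum,
        p.2.IsAtomic ∧ p.2.depth ≤ n := by
      intro p hp
      obtain ⟨_, hΓ, hp⟩ := Multiset.mem_join.1 hp
      obtain ⟨q, hq, rfl⟩ := Multiset.mem_map.1 hΓ
      obtain ⟨p, hp', rfl⟩ := Multiset.mem_map.1 hp
      have hmem : q.2 ∈ P.map Prod.snd + H :=
        Multiset.mem_add.2 (.inl (Multiset.mem_map_of_mem _ hq))
      exact ⟨hat _ hmem p hp', hn _ hmem p hp'⟩
    have h₁ := CutFree.of_valid_of_isAtomic (fun p hp => (hscale p hp).1)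
      (fun p hp => (hscale p hp).2)
      (fun m hm Γ hΓ hv => ihn m hm {Γ} (by simpa [DepthLE] using hΓ) hv) hv
    have h₂ := CutFree.of_combination (G := 0) P hP h₁
    rw [add_comm]
    exact CutFree.weaken H (by simpa using h₂)
  · push Not at hat
    obtain ⟨Γ, hΓ, ⟨r, A⟩, hp, hA⟩ := hat
    obtain ⟨G, rfl⟩ := Multiset.exists_cons_of_mem hΓ
    obtain ⟨Γ, rfl⟩ := Multiset.exists_cons_of_mem hp
    have e : ∀ A : MTerm V, (r, A) ::ₘ Γ = Γ + weighted {r} A := by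
      intro A
      rw [weighted, Multiset.map_singleton, add_comm, Multiset.singleton_add]
    have hval : ∀ I : Interp V, I.Adm →
        0 ≤ r * I.eval A + I.seq Γ ∨ ∃ Γ ∈ G, 0 ≤ I.seq Γ := by
      intro I hI
      simpa using hG I hI
    have hr : (0 : ℝ) < r := r.2
    rw [depthLE_cons] at hn
    obtain ⟨hn, hnG⟩ := hn
    have hnΓ : ∀ p ∈ Γ, p.2.depth ≤ n := fun p hp => hn p (Multiset.mem_cons_of_mem hp)
    have hnA : A.depth ≤ n := hn (r, A) (Multiset.mem_cons_self _ _)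
    rw [e]
    rw [e] at ih
    cases A with
    | zero =>
      obtain ⟨d, hd⟩ := ih _ (hypComplexity_lt G (by
          simp [seqComplexity, weighted, MTerm.complexity])) (Γ ::ₘ G)
        (depthLE_cons.2 ⟨hnΓ, hnG⟩)
        (fun I hI => by simpa [Interp.eval] using hval I hI) rfl
      exact ⟨.zero G Γ {r} d, hd⟩
    | smul s A =>
      obtain ⟨d, hd⟩ := ih _ (hypComplexity_lt G (by
          simp [seqComplexity, weighted, MTerm.complexity]))
        ((Γ + weighted (({r} : Multiset Scalar).map fun r => s * r) A) ::ₘ G)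
        (depthLE_cons.2 ⟨by
          simp only [weighted, Multiset.map_singleton, Multiset.mem_add, Multiset.mem_singleton]
          rintro p (hp | rfl)
          · exact hnΓ p hp
          · exact hnA, hnG⟩)
        (fun I hI => by
          have := hval I hI
          simp only [Multiset.mem_cons, exists_eq_or_imp, Interp.seq_add, Interp.seq_weighted,
            Interp.eval, scalarSum_map_mul, scalarSum_singleton] at this ⊢
          refine this.imp_left fun h => ?_
          linarith) rfl
      exact ⟨.smul G Γ {r} s A d, hd⟩
    | add A B =>
      obtain ⟨d, hd⟩ := ih _ (hypComplexity_lt G (by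
          simp [seqComplexity, weighted, MTerm.complexity]; omega))
        ((Γ + weighted {r} A + weighted {r} B) ::ₘ G)
        (depthLE_cons.2 ⟨by
          simp only [weighted, Multiset.map_singleton, Multiset.mem_add, Multiset.mem_singleton]
          rintro p ((hp | rfl) | rfl)
          · exact hnΓ p hp
          · exact (le_max_left _ _).trans hnA
          · exact (le_max_right _ _).trans hnA, hnG⟩)
        (fun I hI => by
          have := hval I hI
          simp only [Multiset.mem_cons, exists_eq_or_imp, Interp.seq_add, Interp.seq_weighted,
            Interp.eval, scalarSum_singleton] at this ⊢
          refine this.imp_left fun h => ?_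
          linarith) rfl
      exact ⟨.add G Γ {r} A B d, hd⟩
    | sup A B =>
      obtain ⟨d, hd⟩ := ih _ (hypComplexity_lt_of_two G
          (by simp +arith [seqComplexity, weighted, MTerm.complexity])
          (by simp +arith [seqComplexity, weighted, MTerm.complexity]))
        ((Γ + weighted {r} A) ::ₘ (Γ + weighted {r} B) ::ₘ G)
        (by
          simp only [depthLE_cons, weighted, Multiset.map_singleton, Multiset.mem_add,
            Multiset.mem_singleton]
          refine ⟨?_, ?_, hnG⟩
          · rintro p (hp | rfl)
            · exact hnΓ p hp
            · exact (le_max_left _ _).trans hnA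
          · rintro p (hp | rfl)
            · exact hnΓ p hp
            · exact (le_max_right _ _).trans hnA)
        (fun I hI => by
          have := hval I hI
          simp only [Multiset.mem_cons, exists_eq_or_imp, Interp.seq_add, Interp.seq_weighted,
            Interp.eval, scalarSum_singleton] at this ⊢
          rcases this with h | h
          · rcases max_choice (I.eval A) (I.eval B) with hm | hm <;> rw [hm] at h
            · left; linarith
            · right; left; linarith
          · exact .inr (.inr h)) rfl
      exact ⟨.sup G Γ {r} A B d, hd⟩
    | inf A B =>
      obtain ⟨d₁, hd₁⟩ := ih _ (hypComplexity_lt G (by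
          simp +arith [seqComplexity, weighted, MTerm.complexity]))
        ((Γ + weighted {r} A) ::ₘ G)
        (depthLE_cons.2 ⟨by
          simp only [weighted, Multiset.map_singleton, Multiset.mem_add, Multiset.mem_singleton]
          rintro p (hp | rfl)
          · exact hnΓ p hp
          · exact (le_max_left _ _).trans hnA, hnG⟩)
        (fun I hI => by
          have := hval I hI
          simp only [Multiset.mem_cons, exists_eq_or_imp, Interp.seq_add, Interp.seq_weighted,
            Interp.eval, scalarSum_singleton] at this ⊢
          refine this.imp_left fun h => ?_
          have := mul_le_mul_of_nonneg_left (min_le_left (I.eval A) (I.eval B)) hr.le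
          linarith) rfl
      obtain ⟨d₂, hd₂⟩ := ih _ (hypComplexity_lt G (by
          simp +arith [seqComplexity, weighted, MTerm.complexity]))
        ((Γ + weighted {r} B) ::ₘ G)
        (depthLE_cons.2 ⟨by
          simp only [weighted, Multiset.map_singleton, Multiset.mem_add, Multiset.mem_singleton]
          rintro p (hp | rfl)
          · exact hnΓ p hp
          · exact (le_max_right _ _).trans hnA, hnG⟩)
        (fun I hI => by
          have := hval I hI
          simp only [Multiset.mem_cons, exists_eq_or_imp, Interp.seq_add, Interp.seq_weighted,
            Interp.eval, scalarSum_singleton] at this ⊢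
          refine this.imp_left fun h => ?_
          have := mul_le_mul_of_nonneg_left (min_le_right (I.eval A) (I.eval B)) hr.le
          linarith) rfl
      exact ⟨.inf G Γ {r} A B d₁ d₂, hd₁, hd₂⟩
    | _ => exact absurd trivial hA

/-- Every valid hypersequent has a CAN-free derivation. -/
theorem CutFree.of_valid {G : Multiset (Sequent V)} (hG : Valid G) : CutFree G := by
  refine CutFree.of_valid_of_depthLE
    (G.map fun Γ => (Γ.map fun p => p.2.depth).sum).sum G (fun Γ hΓ p hp => ?_) hG
  exact (Multiset.single_le_sum (fun _ _ => Nat.zero_le _) _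
      (Multiset.mem_map_of_mem (fun p : WTerm V => p.2.depth) hp)).trans
    (Multiset.single_le_sum (fun _ _ => Nat.zero_le _) _
      (Multiset.mem_map_of_mem (fun Γ : Sequent V => (Γ.map fun p => p.2.depth).sum) hΓ))

end Completeness

theorem mainTheorem1 (V : Type*) [Countable V] (G : Hypersequent V)
    (hG : Nonempty (HMR G.1)) : ∃ d : HMR G.1, d.CANFree := by
  obtain ⟨d⟩ := hG
  exact CutFree.of_valid d.valid
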